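/- A condensation of a topological space $X$ onto a topological space $Y$ is a continuous bijection $X\to Y$; $X$ condenses onto $Y$ if one exists. A space $X$ is homogeneous if for all $x,y\in X$ there is a homeomorphism $h:X\to X$ with $h(x)=y$. The real line $\mathbb{R}$ (with its usual topology) condenses onto a compact Hausdorff space; indeed it condenses onto the figure eight, that is, the compact subspace $\{z\in\mathbb{C}:|z-1|=1\}\cup\{z\in\mathbb{C}:|z+1|=1\}$ of the plane. However, $\mathbb{R}$ does not condense onto any compact homogeneous Hausdorff space. -/

import Mathlib

/-- A condensation of `X` onto `Y`: a continuous bijection `X → Y`. -/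
def IsCondensation {X Y : Type*} [TopologicalSpace X] [TopologicalSpace Y] (f : X → Y) : Prop :=
  Continuous f ∧ Function.Bijective f

/-- `X` condenses onto `Y` if there is a condensation of `X` onto `Y`. -/
def CondensesOnto (X Y : Type*) [TopologicalSpace X] [TopologicalSpace Y] : Prop :=
  ∃ f : X → Y, IsCondensation f

/-- A space is homogeneous if any point can be moved to any other point
by a homeomorphism of the space onto itself. -/
def IsHomogeneousSpace (X : Type*) [TopologicalSpace X] : Prop :=
  ∀ x y : X, ∃ h : X ≃ₜ X, h x = y

/-- The figure eight: the union of two circles in the plane that touch in exactly one point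
(the origin), used with its subspace topology. -/
def figureEight : Set ℂ :=
  Metric.sphere (1 : ℂ) 1 ∪ Metric.sphere (-1 : ℂ) 1

/-!
Away from `0`, inversion `z ↦ z⁻¹` turns the two circles of the figure eight into the vertical
lines `re = 1/2` and `re = -1/2`. Since `t ↦ t - 1/t` maps each of the two half-lines `t > 0` and
`t < 0` homeomorphically onto `ℝ`, the formula `t / (|t|/2 + i (t² - 1))` sends each open half-line
onto one punctured circle and `0` to `0`; it is the condensation `figureEightCurve`.

For the negative part let `f : ℝ → X` be a condensation onto a compact Hausdorff space. Then `X` is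
the union of the compact sets `f '' [-n, n]`, so by the Baire category theorem one of them has
interior points, and near such a point the inverse of `f` is continuous
(`exists_continuousAt_invFun`): there `X` looks like an interval. If `X` is homogeneous, it looks
like an interval at every point, and a continuous injection between one-dimensional manifolds is
open by the intermediate value theorem (`image_Icc_mem_nhds_of_injOn`). Hence `f` is open
(`IsCondensation.isOpenMap`), so it is a homeomorphism and `ℝ` would be compact.
-/

open Set Filter Topology

/-! ### Condensations of the line onto homogeneous compact spaces -/

/-- Invariance of domain in dimension one. -/
lemma image_Icc_mem_nhds_of_injOn {φ : ℝ → ℝ} {a b x : ℝ} (hx : x ∈ Ioo a b)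
    (hc : ContinuousOn φ (Icc a b)) (hi : InjOn φ (Icc a b)) :
    φ '' Icc a b ∈ 𝓝 (φ x) := by
  have hab : a ≤ b := (hx.1.trans hx.2).le
  have ha : a ∈ Icc a b := left_mem_Icc.2 hab
  have hb : b ∈ Icc a b := right_mem_Icc.2 hab
  have hx' : x ∈ Icc a b := Ioo_subset_Icc_self hx
  rcases hc.strictMonoOn_of_injOn_Icc' hab hi with h | h
  · exact mem_of_superset (Icc_mem_nhds (h ha hx' hx.1) (h hx' hb hx.2))
      (intermediate_value_Icc hab hc)
  · exact mem_of_superset (Icc_mem_nhds (h hx' hb hx.2) (h ha hx' hx.1))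
      (intermediate_value_Icc' hab hc)

lemma continuousOn_invFun_image {A X : Type*} [Nonempty A] [TopologicalSpace A]
    [TopologicalSpace X] [T2Space X] {f : A → X} (hf : Continuous f) (hi : Function.Injective f)
    {K : Set A} (hK : IsCompact K) : ContinuousOn (Function.invFun f) (f '' K) := by
  rw [continuousOn_iff_isClosed]
  intro t ht
  refine ⟨f '' (K ∩ t), ((hK.inter_right ht).image hf).isClosed, ?_⟩
  ext y
  constructor
  · rintro ⟨hy, x, hx, rfl⟩
    rw [mem_preimage, Function.leftInverse_invFun hi] at hy
    exact ⟨⟨x, ⟨hx, hy⟩, rfl⟩, x, hx, rfl⟩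
  · rintro ⟨⟨x, ⟨hx, hxt⟩, rfl⟩, hy⟩
    refine ⟨?_, hy⟩
    rwa [mem_preimage, Function.leftInverse_invFun hi]

/-- By the Baire category theorem, the inverse of a condensation of `ℝ` onto a compact Hausdorff
space is continuous on some nonempty open set. -/
lemma exists_continuousAt_invFun {X : Type*} [TopologicalSpace X] [CompactSpace X] [T2Space X]
    {f : ℝ → X} (hf : IsCondensation f) :
    ∃ U : Set X, IsOpen U ∧ U.Nonempty ∧ ∀ y ∈ U, ContinuousAt (Function.invFun f) y := by
  have : Nonempty X := ⟨f 0⟩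
  have hK (n : ℕ) : IsCompact (Icc (-n : ℝ) n) := isCompact_Icc
  obtain ⟨n, hn⟩ := nonempty_interior_of_iUnion_of_closed
    (f := fun n : ℕ ↦ f '' Icc (-n : ℝ) n) (fun n ↦ ((hK n).image hf.1).isClosed) <| by
      refine eq_univ_of_forall fun y ↦ ?_
      obtain ⟨x, rfl⟩ := hf.2.2 y
      obtain ⟨n, hn⟩ := exists_nat_ge |x|
      exact mem_iUnion.2 ⟨n, x, abs_le.1 hn, rfl⟩
  exact ⟨_, isOpen_interior, hn, fun y hy ↦
    (continuousOn_invFun_image hf.1 hf.2.1 (hK n)).continuousAt (mem_interior_iff_mem_nhds.1 hy)⟩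

/-- A homeomorphism `h` moving `f x` into the open set where the inverse of `f` is continuous
carries the chart found there to a neighbourhood of `f x`. -/
lemma IsCondensation.isOpenMap {X : Type*} [TopologicalSpace X] [CompactSpace X] [T2Space X]
    (hX : IsHomogeneousSpace X) {f : ℝ → X} (hf : IsCondensation f) : IsOpenMap f := by
  obtain ⟨U, hU, ⟨y₀, hy₀⟩, hinv⟩ := exists_continuousAt_invFun hf
  have hg : Function.Injective (Function.invFun f) :=
    (Function.rightInverse_invFun hf.2.2).injective
  refine isOpenMap_iff_nhds_le.2 fun x S hS ↦ ?_
  obtain ⟨h, hh⟩ := hX (f x) y₀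
  have hhf : Continuous fun t ↦ h (f t) := h.continuous.comp hf.1
  have hV : (fun t ↦ h (f t)) ⁻¹' U ∈ 𝓝 x :=
    (hU.preimage hhf).mem_nhds (by rwa [mem_preimage, hh])
  obtain ⟨ε, hε, hsub⟩ := Metric.nhds_basis_closedBall.mem_iff.1 (inter_mem hS hV)
  rw [Real.closedBall_eq_Icc] at hsub
  -- `φ` reads `h ∘ f` in the chart `f⁻¹` around `y₀`.
  let φ : ℝ → ℝ := fun t ↦ Function.invFun f (h (f t))
  have hφc : ContinuousOn φ (Icc (x - ε) (x + ε)) := fun t ht ↦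
    (ContinuousAt.comp (f := fun t ↦ h (f t)) (hinv _ (hsub ht).2)
      hhf.continuousAt).continuousWithinAt
  have hφi : Function.Injective φ := hg.comp (h.injective.comp hf.2.1)
  have hφ := image_Icc_mem_nhds_of_injOn (x := x) ⟨by linarith, by linarith⟩ hφc hφi.injOn
  have hφx : ContinuousAt (fun z ↦ Function.invFun f (h z)) (f x) :=
    ContinuousAt.comp (f := h) (hinv _ (by rwa [hh])) h.continuous.continuousAt
  filter_upwards [hφx hφ] with z ⟨t, ht, htz⟩
  have hzt : f t = z := h.injective (hg htz)
  exact hzt ▸ (hsub ht).1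

theorem not_condensesOnto_of_isHomogeneousSpace (X : Type*) [TopologicalSpace X] [CompactSpace X]
    [T2Space X] (hX : IsHomogeneousSpace X) : ¬ CondensesOnto ℝ X := by
  rintro ⟨f, hf⟩
  let e : ℝ ≃ₜ X := (Equiv.ofBijective f hf.2).toHomeomorphOfContinuousOpen hf.1 (hf.isOpenMap hX)
  exact not_compactSpace_iff.2 inferInstance e.symm.compactSpace

/-! ### The figure eight -/

/-- A parametrization of the figure eight: for `t ≠ 0` its inverse is
`|t| / (2 t) + i (t - 1 / t)`, which lies on the line `re = 1 / 2` or `re = -1 / 2`. -/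
noncomputable def figureEightCurve (t : ℝ) : ℂ :=
  t / ⟨|t| / 2, t ^ 2 - 1⟩

lemma figureEightCurve_denom_ne_zero (t : ℝ) : (⟨|t| / 2, t ^ 2 - 1⟩ : ℂ) ≠ 0 := by
  intro h
  have h1 : |t| / 2 = 0 := congrArg Complex.re h
  have h2 : t ^ 2 - 1 = 0 := congrArg Complex.im h
  have h3 : t = 0 := abs_eq_zero.1 (by linarith)
  norm_num [h3] at h2

lemma continuous_figureEightCurve : Continuous figureEightCurve := by
  refine Complex.continuous_ofReal.div ?_ figureEightCurve_denom_ne_zero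
  have : (fun t : ℝ ↦ (⟨|t| / 2, t ^ 2 - 1⟩ : ℂ)) =
      fun t : ℝ ↦ ((|t| / 2 : ℝ) : ℂ) + ((t ^ 2 - 1 : ℝ) : ℂ) * Complex.I := by
    ext t
    exact Complex.mk_eq_add_mul_I _ _
  rw [this]
  fun_prop

/-- The figure eight in real coordinates: its two circles are `x² + y² = 2x` and
`x² + y² = -2x`. -/
lemma mem_figureEight_iff (z : ℂ) :
    z ∈ figureEight ↔ Complex.normSq z = 2 * z.re ∨ Complex.normSq z = -(2 * z.re) := by
  have key (w : ℂ) : ‖w‖ = 1 ↔ Complex.normSq w = 1 := by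
    rw [Complex.normSq_eq_norm_sq, pow_eq_one_iff_of_nonneg (norm_nonneg w) two_ne_zero]
  simp only [figureEight, mem_union, mem_sphere_iff_norm, key, Complex.normSq_apply,
    Complex.sub_re, Complex.sub_im, Complex.one_re, Complex.one_im, Complex.neg_re,
    Complex.neg_im]
  constructor
  · rintro (h | h)
    · left; linarith
    · right; linarith
  · rintro (h | h)
    · left; linarith
    · right; linarith

lemma figureEightCurve_mem (t : ℝ) : figureEightCurve t ∈ figureEight := by
  have hD : Complex.normSq ⟨|t| / 2, t ^ 2 - 1⟩ ≠ 0 :=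
    (map_ne_zero Complex.normSq).2 (figureEightCurve_denom_ne_zero t)
  rw [mem_figureEight_iff, figureEightCurve, map_div₀, Complex.div_re]
  simp only [Complex.ofReal_re, Complex.ofReal_im, Complex.normSq_ofReal]
  rcases abs_choice t with h | h
  · left
    rw [h] at hD ⊢
    field_simp
    ring
  · right
    rw [h] at hD ⊢
    field_simp
    ring

lemma figureEightCurve_eq_iff (t : ℝ) (z : ℂ) :
    figureEightCurve t = z ↔
      t = z.re * (|t| / 2) - z.im * (t ^ 2 - 1) ∧
        0 = z.re * (t ^ 2 - 1) + z.im * (|t| / 2) := by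
  rw [figureEightCurve, div_eq_iff (figureEightCurve_denom_ne_zero t), Complex.ext_iff]
  simp

lemma figureEightCurve_injective : Function.Injective figureEightCurve := by
  intro s t h
  rw [figureEightCurve, figureEightCurve, div_eq_div_iff (figureEightCurve_denom_ne_zero s)
    (figureEightCurve_denom_ne_zero t), Complex.ext_iff] at h
  simp only [Complex.mul_re, Complex.mul_im, Complex.ofReal_re, Complex.ofReal_im] at h
  obtain ⟨h1, h2⟩ := h
  -- The imaginary parts give `(s - t) * (s * t + 1) = 0` and the real parts rule out `s * t = -1`.
  have h3 : (s - t) * (s * t + 1) = 0 := by linarith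
  rcases mul_eq_zero.1 h3 with h4 | h4
  · linarith
  · exfalso
    have h5 : s * |t| = t * |s| := by linarith
    rcases abs_cases s with ⟨hs, hs'⟩ | ⟨hs, hs'⟩ <;>
      rcases abs_cases t with ⟨ht, ht'⟩ | ⟨ht, ht'⟩ <;>
      rw [hs, ht] at h5 <;> nlinarith

lemma exists_figureEightCurve_eq {z : ℂ} (hz : z ∈ figureEight) :
    ∃ t, figureEightCurve t = z := by
  rcases eq_or_ne z 0 with rfl | hz0
  · exact ⟨0, by simp [figureEightCurve]⟩
  have hN : 0 < Complex.normSq z := Complex.normSq_pos.2 hz0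
  rw [mem_figureEight_iff] at hz
  -- `t` must solve `t - 1 / t = σ`, where `σ` is the imaginary part of `z⁻¹`; the two roots of
  -- this quadratic equation have opposite signs, one for each circle.
  let σ : ℝ := -z.im / Complex.normSq z
  have hσ : z.im = -σ * Complex.normSq z := by simp only [σ]; field_simp
  have hsq : √(σ ^ 2 + 4) ^ 2 = σ ^ 2 + 4 := Real.sq_sqrt (by positivity)
  have hlt : |σ| < √(σ ^ 2 + 4) := by
    rw [← Real.sqrt_sq_eq_abs]
    exact Real.sqrt_lt_sqrt (sq_nonneg σ) (by linarith)
  have hlt' := abs_lt.1 hlt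
  have hn : Complex.normSq z = z.re * z.re + z.im * z.im := Complex.normSq_apply z
  rcases hz with h | h
  · have hre : z.re = Complex.normSq z / 2 := by linarith
    have hq : Complex.normSq z * (1 / 4 + σ ^ 2) = 1 := by
      rw [hre, hσ] at hn
      apply mul_left_cancel₀ hN.ne'
      linarith
    obtain ⟨t, ht0, ht⟩ : ∃ t : ℝ, 0 < t ∧ t ^ 2 - 1 = σ * t :=
      ⟨(σ + √(σ ^ 2 + 4)) / 2, by linarith, by linarith⟩
    refine ⟨t, (figureEightCurve_eq_iff t z).2 ?_⟩
    rw [abs_of_pos ht0, ht, hσ, hre]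
    exact ⟨by linear_combination -t * hq, by ring⟩
  · have hre : z.re = -(Complex.normSq z / 2) := by linarith
    have hq : Complex.normSq z * (1 / 4 + σ ^ 2) = 1 := by
      rw [hre, hσ] at hn
      apply mul_left_cancel₀ hN.ne'
      linarith
    obtain ⟨t, ht0, ht⟩ : ∃ t : ℝ, t < 0 ∧ t ^ 2 - 1 = σ * t :=
      ⟨(σ - √(σ ^ 2 + 4)) / 2, by linarith, by linarith⟩
    refine ⟨t, (figureEightCurve_eq_iff t z).2 ?_⟩
    rw [abs_of_neg ht0, ht, hσ, hre]
    exact ⟨by linear_combination -t * hq, by ring⟩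

theorem condensesOnto_figureEight : CondensesOnto ℝ figureEight := by
  refine ⟨fun t ↦ ⟨figureEightCurve t, figureEightCurve_mem t⟩,
    continuous_figureEightCurve.subtype_mk _, fun s t h ↦ ?_, fun z ↦ ?_⟩
  · exact figureEightCurve_injective (congrArg Subtype.val h)
  · obtain ⟨t, ht⟩ := exists_figureEightCurve_eq z.2
    exact ⟨t, Subtype.ext ht⟩

theorem compactSpace_figureEight : CompactSpace figureEight :=
  isCompact_iff_compactSpace.1 ((isCompact_sphere _ _).union (isCompact_sphere _ _))

theorem proposition4p1 :
    (∃ (X : Type) (_ : TopologicalSpace X),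
      CompactSpace X ∧ T2Space X ∧ CondensesOnto ℝ X) ∧
    (CompactSpace figureEight ∧ CondensesOnto ℝ figureEight) ∧
    (∀ (X : Type*) [TopologicalSpace X] [CompactSpace X] [T2Space X],
      IsHomogeneousSpace X → ¬ CondensesOnto ℝ X) :=
  ⟨⟨figureEight, inferInstance, compactSpace_figureEight, inferInstance,
    condensesOnto_figureEight⟩, ⟨compactSpace_figureEight, condensesOnto_figureEight⟩,
    fun X _ _ _ ↦ not_condensesOnto_of_isHomogeneousSpace X⟩
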